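/- Let $\sigma>0$ and $1<p<\infty$, and let $B^p_\sigma$ be the space of all complex-valued $f\in L^p(\mathbb R)$ whose distributional Fourier transform (normalized by $\hat f(x)=\int_{\mathbb R} f(t)e^{-ixt}\,dt$) vanishes outside $[-\sigma,\sigma]$. For $f\in B^p_\sigma$ and $\tau>0$ put \[ c_{k,\tau}=\frac1{2\tau}\int_{-\tau}^{\tau}f(t)e^{-i\frac{\pi}{\tau}kt}\,dt,\qquad f_\tau(x)=\sum_{k=-N}^{N}c_{k,\tau}e^{i\frac{\pi}{\tau}kx},\quad N=\lfloor\sigma\tau/\pi\rfloor,\qquad \varphi_{f,\tau}=f_\tau\cdot\chi_{[-\tau,\tau]}, \] where $\chi_{[-\tau,\tau]}$ is the indicator function of $[-\tau,\tau]$. Then for every $f\in B^p_\sigma$ \[ \lim_{\tau\to\infty}\|f-\varphi_{f,\tau}\|_{L^\infty(\mathbb R)}=0 ; \] that is, $f$ has a continuous representative, and $\varphi_{f,\tau}$ converges to it uniformly on $\mathbb R$ as $\tau\to\infty$. In particular $\varphi_{f,\tau}$ converges narrowly to $f$ as $\tau\to\infty$: $f$ and all $\varphi_{f,\tau}$ belong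 to $L^\infty(\mathbb R)$, $\varphi_{f,\tau}\to f$ uniformly on every compact subset of $\mathbb R$ (in the sense of $L^\infty$), and $\|\varphi_{f,\tau}\|_{L^\infty(\mathbb R)}\to\|f\|_{L^\infty(\mathbb R)}$. -/

import Mathlib

open MeasureTheory Filter Topology
open scoped ENNReal FourierTransform SchwartzMap

noncomputable section

/-- The Bernstein space of exponent `p` and bandwidth `σ`: the classes `f ∈ L^p(ℝ)` whose
distributional Fourier transform vanishes outside `[-σ, σ]`, for the angular normalization
`∫ f(t) e^{-ixt} dt`.  Mathlib's transform `𝓕` uses the kernel `e^{-2πixt}` instead, so that its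
value at `x` is the angular transform at `2πx`, and the interval becomes `[-σ/(2π), σ/(2π)]`. -/
def bernsteinSpace (σ : ℝ) (p : ℝ≥0∞) [Fact (1 ≤ p)] :
    Submodule ℂ (Lp ℂ p (volume : Measure ℝ)) where
  carrier := {f | Distribution.IsVanishingOn (𝓕 (Lp.toTemperedDistribution f) : 𝓢'(ℝ, ℂ))
    (Set.Icc (-(σ / (2 * Real.pi))) (σ / (2 * Real.pi)))ᶜ}
  zero_mem' := by
    intro u _
    rw [TemperedDistribution.fourier_apply]
    change Lp.toTemperedDistributionCLM ℂ volume p 0 _ = 0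
    simp
  add_mem' := by
    intro f g hf hg u hu
    have h1 := hf u hu
    have h2 := hg u hu
    rw [TemperedDistribution.fourier_apply] at h1 h2 ⊢
    change Lp.toTemperedDistributionCLM ℂ volume p f _ = 0 at h1
    change Lp.toTemperedDistributionCLM ℂ volume p g _ = 0 at h2
    change Lp.toTemperedDistributionCLM ℂ volume p (f + g) _ = 0
    rw [map_add]
    change Lp.toTemperedDistributionCLM ℂ volume p f _ +
      Lp.toTemperedDistributionCLM ℂ volume p g _ = 0
    rw [h1, h2, add_zero]
  smul_mem' := by
    intro c f hf u hu
    have h1 := hf u hu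
    rw [TemperedDistribution.fourier_apply] at h1 ⊢
    change Lp.toTemperedDistributionCLM ℂ volume p f _ = 0 at h1
    change Lp.toTemperedDistributionCLM ℂ volume p (c • f) _ = 0
    rw [map_smul]
    change c • Lp.toTemperedDistributionCLM ℂ volume p f _ = 0
    rw [h1, smul_zero]

/-- The Fourier coefficient `c_{k,τ} = (1 / (2τ)) ∫_{-τ}^{τ} f(t) e^{-i(π/τ)kt} dt`. -/
def expCoeff (f : ℝ → ℂ) (τ : ℝ) (k : ℤ) : ℂ :=
  (1 / (2 * (τ : ℂ))) *
    ∫ t in (-τ)..τ, f t * Complex.exp (-(Complex.I * (Real.pi / τ) * k * t))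

/-- The trigonometric sum `f_τ(x) = ∑_{k=-N}^{N} c_{k,τ} e^{i(π/τ)kx}` with `N = ⌊στ/π⌋`. -/
def trigSum (σ : ℝ) (f : ℝ → ℂ) (τ x : ℝ) : ℂ :=
  ∑ k ∈ Finset.Icc (-⌊σ * τ / Real.pi⌋) ⌊σ * τ / Real.pi⌋,
    expCoeff f τ k * Complex.exp (Complex.I * (Real.pi / τ) * k * x)

/-- The truncated trigonometric sum `φ_{f,τ} = f_τ · χ_{[-τ,τ]}`. -/
def truncTrigSum (σ : ℝ) (f : ℝ → ℂ) (τ : ℝ) : ℝ → ℂ :=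
  (Set.Icc (-τ) τ).indicator (trigSum σ f τ)

/-- Narrow convergence of a family in `L^∞(ℝ)` along a filter: uniform convergence (in the sense
of `L^∞`) on every compact subset of `ℝ`, together with convergence of the `L^∞(ℝ)` norms. -/
structure ConvergesNarrowly {ι : Type*} (l : Filter ι) (ψ : ι → ℝ → ℂ) (ψ₀ : ℝ → ℂ) : Prop where
  memLp : ∀ i, MemLp (ψ i) ∞ volume
  memLp_limit : MemLp ψ₀ ∞ volume
  uniform_on_compacts : ∀ K : Set ℝ, IsCompact K →
    Tendsto (fun i => eLpNorm (fun x => ψ₀ x - ψ i x) ∞ (volume.restrict K)) l (𝓝 0)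
  norm_tendsto : Tendsto (fun i => eLpNorm (ψ i) ∞ volume) l (𝓝 (eLpNorm ψ₀ ∞ volume))

end

/-!
The trigonometric sum `f_τ` is the convolution of `f · χ_{[-τ,τ]}` with a `2τ`-periodic Dirichlet
kernel. The part of this kernel carried by `m` consecutive frequencies is bounded on a period by
`min (A, 1 / (2|u|))`, `A = m / (2τ)`, so its `L^{p'}` norm is `O(A^{1/p})`, with a constant that
depends only on `p`, and Hölder's inequality (`norm_blockSum_le`) gives two bounds uniform in `τ`:

* `‖f_τ‖_∞ ≤ C ‖f‖_p`, since `f_τ` has `O(τ)` frequencies (`exists_norm_trigSum_le`);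
* replacing the bandwidth `σ` by `σ + δ` changes `f_τ` by `O((δ + 1/τ)^{1/p}) ‖f‖_p` in the sup norm
  (`norm_trigSum_sub_trigSum_le`).

For a band-limited Schwartz function `s` the coefficients `c_{k,τ}` are nearly `1 / (2τ)` times
the values of the Fourier transform at the points of a lattice, so that by Poisson summation `s_τ` is nearly the
`2τ`-periodization of `s`, and the convergence is uniform
(`tendstoUniformly_truncTrigSum_schwartz`).

Convolution with a Schwartz function whose Fourier transform is a smooth cutoff equal to `1` near
`[-σ, σ]` reproduces `f ∈ B^p_σ`; applied to Schwartz functions approximating `f` in `L^p`, it gives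
Schwartz functions of bandwidth `σ + δ` that converge to `f` in `L^p`
(`exists_bandlimited_schwartz_tendsto`). The slightly larger bandwidth is harmless by the second
bound, and the first bound carries the uniform convergence over to `f`. It also yields Nikolskii's
inequality for band-limited Schwartz functions, by which the approximants converge uniformly, to the
continuous representative of `f`.
-/

/-! ### Dirichlet kernels of blocks of frequencies -/

/-- The kernel `(1 / (2τ)) ∑_{k ∈ s} e^{i(π/τ)ku}` whose integral against `f` over `[-τ, τ]` is the
part of the Fourier series of `f` with frequencies in `s`. -/
noncomputable def blockKernel (s : Finset ℤ) (τ u : ℝ) : ℂ :=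
  (1 / (2 * (τ : ℂ))) * ∑ k ∈ s, Complex.exp (Complex.I * (Real.pi / τ) * k * u)

/-- The part `∑_{k ∈ s} c_{k,τ} e^{i(π/τ)kx}` of the Fourier series of `f` on `[-τ, τ]`. -/
noncomputable def blockSum (s : Finset ℤ) (f : ℝ → ℂ) (τ x : ℝ) : ℂ :=
  ∑ k ∈ s, expCoeff f τ k * Complex.exp (Complex.I * (Real.pi / τ) * k * x)

lemma norm_one_div_two_mul {τ : ℝ} (hτ : 0 < τ) : ‖(1 / (2 * (τ : ℂ)))‖ = 1 / (2 * τ) := by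
  rw [norm_div, norm_mul, Complex.norm_real, Real.norm_of_nonneg hτ.le]
  simp

lemma norm_exp_frequency (τ : ℝ) (k : ℤ) (x : ℝ) :
    ‖Complex.exp (Complex.I * (Real.pi / τ) * k * x)‖ = 1 := by
  rw [show Complex.I * (Real.pi / τ) * k * x = ((Real.pi / τ * k * x : ℝ) : ℂ) * Complex.I by
    push_cast; ring, Complex.norm_exp_ofReal_mul_I]

lemma trigSum_eq_blockSum (σ : ℝ) (f : ℝ → ℂ) (τ x : ℝ) :
    trigSum σ f τ x =
      blockSum (Finset.Icc (-⌊σ * τ / Real.pi⌋) ⌊σ * τ / Real.pi⌋) f τ x := rfl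

lemma blockSum_eq_integral (s : Finset ℤ) {f : ℝ → ℂ} {τ : ℝ}
    (hf : IntervalIntegrable f volume (-τ) τ) (x : ℝ) :
    blockSum s f τ x = ∫ t in (-τ)..τ, f t * blockKernel s τ (x - t) := by
  have h : ∀ t, f t * blockKernel s τ (x - t) = ∑ k ∈ s, (1 / (2 * (τ : ℂ))) *
      (f t * Complex.exp (-(Complex.I * (Real.pi / τ) * k * t))) *
        Complex.exp (Complex.I * (Real.pi / τ) * k * x) := by
    intro t
    rw [blockKernel, Finset.mul_sum, Finset.mul_sum]
    refine Finset.sum_congr rfl fun k _ => ?_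
    rw [show Complex.I * (Real.pi / τ) * k * ((x - t : ℝ) : ℂ) =
      -(Complex.I * (Real.pi / τ) * k * t) + Complex.I * (Real.pi / τ) * k * x by push_cast; ring,
      Complex.exp_add]
    ring
  simp_rw [h]
  rw [intervalIntegral.integral_finsetSum]
  · refine Finset.sum_congr rfl fun k _ => ?_
    rw [intervalIntegral.integral_mul_const, intervalIntegral.integral_const_mul, expCoeff]
  · intro k _
    refine IntervalIntegrable.mul_const (IntervalIntegrable.const_mul ?_ _) _
    exact hf.mul_continuousOn (by fun_prop)

lemma blockKernel_periodic (s : Finset ℤ) {τ : ℝ} (hτ : 0 < τ) :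
    Function.Periodic (blockKernel s τ) (2 * τ) := by
  intro u
  unfold blockKernel
  congr 1
  refine Finset.sum_congr rfl fun k _ => ?_
  have hτ' : (τ : ℂ) ≠ 0 := by exact_mod_cast hτ.ne'
  rw [Complex.exp_eq_exp_iff_exists_int]
  refine ⟨k, ?_⟩
  push_cast
  field_simp

lemma blockKernel_continuous (s : Finset ℤ) (τ : ℝ) : Continuous (blockKernel s τ) := by
  unfold blockKernel
  fun_prop

lemma norm_blockKernel_le_card (s : Finset ℤ) {τ : ℝ} (hτ : 0 < τ) (u : ℝ) :
    ‖blockKernel s τ u‖ ≤ s.card / (2 * τ) := by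
  have h : ‖∑ k ∈ s, Complex.exp (Complex.I * (Real.pi / τ) * k * u)‖ ≤ s.card := by
    refine (norm_sum_le _ _).trans ?_
    rw [Finset.sum_congr rfl (g := fun _ => (1 : ℝ))]
    · simp
    · intro k _
      exact norm_exp_frequency τ k u
  rw [blockKernel, norm_mul]
  have := norm_one_div_two_mul hτ
  rw [this, div_eq_mul_one_div (s.card : ℝ), mul_comm]
  gcongr

lemma sum_Icc_exp_mul_sub_one (a b : ℤ) (hab : a ≤ b) (w : ℂ) :
    (∑ k ∈ Finset.Icc a b, Complex.exp (k * w)) * (Complex.exp w - 1) =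
      Complex.exp ((b + 1) * w) - Complex.exp (a * w) := by
  induction b, hab using Int.leInduction with
  | base => simp [add_mul, Complex.exp_add]; ring_nf
  | succ b hab ih =>
    rw [← Finset.insert_Icc_right_eq_Icc_add_one (by omega), Finset.sum_insert (by simp), add_mul, ih]
    push_cast
    simp only [add_mul, Complex.exp_add]
    ring_nf

lemma abs_mul_norm_blockKernel_Icc_le (a b : ℤ) {τ : ℝ} (hτ : 0 < τ) {u : ℝ} (hu : |u| ≤ τ) :
    |u| * ‖blockKernel (Finset.Icc a b) τ u‖ ≤ 1 / 2 := by
  rcases lt_or_ge b a with hab | hab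
  · simp [blockKernel, Finset.Icc_eq_empty (not_le.2 hab)]
  set θ : ℝ := Real.pi / τ * u with hθ
  have hsum : ∑ k ∈ Finset.Icc a b, Complex.exp (Complex.I * (Real.pi / τ) * k * u) =
      ∑ k ∈ Finset.Icc a b, Complex.exp (k * (Complex.I * θ)) := by
    refine Finset.sum_congr rfl fun k _ => ?_
    congr 1
    rw [hθ]
    push_cast
    ring
  set S := ∑ k ∈ Finset.Icc a b, Complex.exp (k * (Complex.I * θ)) with hS
  have hnorm : ∀ m : ℤ, ‖Complex.exp ((m : ℂ) * (Complex.I * θ))‖ = 1 := by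
    intro m
    rw [show (m : ℂ) * (Complex.I * θ) = ((m * θ : ℝ) : ℂ) * Complex.I by push_cast; ring,
      Complex.norm_exp_ofReal_mul_I]
  have h2 : ‖S‖ * ‖Complex.exp (Complex.I * θ) - 1‖ ≤ 2 := by
    rw [← norm_mul, hS, sum_Icc_exp_mul_sub_one a b hab]
    refine (norm_sub_le _ _).trans ?_
    have h1 := hnorm (b + 1)
    push_cast at h1
    rw [h1, hnorm a]
    norm_num
  have h3 : 2 * |u| / τ ≤ ‖Complex.exp (Complex.I * θ) - 1‖ := by
    rw [Complex.norm_exp_I_mul_ofReal_sub_one]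
    have h4 : |θ / 2| ≤ Real.pi / 2 := by
      rw [hθ, abs_div, abs_mul, abs_of_pos (by positivity : 0 < Real.pi / τ), abs_two]
      have : Real.pi / τ * |u| ≤ Real.pi / τ * τ := by gcongr
      rw [div_mul_cancel₀ _ hτ.ne'] at this
      linarith
    have h5 := Real.mul_abs_le_abs_sin h4
    rw [norm_mul, Real.norm_eq_abs, Real.norm_eq_abs, abs_two]
    calc 2 * |u| / τ = 2 * (2 / Real.pi * |θ / 2|) := by
          rw [hθ, abs_div, abs_mul, abs_of_pos (by positivity : 0 < Real.pi / τ), abs_two]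
          field_simp
      _ ≤ _ := by gcongr
  have h6 : ‖S‖ * (2 * |u| / τ) ≤ 2 := (mul_le_mul_of_nonneg_left h3 (norm_nonneg _)).trans h2
  rw [blockKernel, hsum, norm_mul]
  have := norm_one_div_two_mul hτ
  rw [this]
  calc |u| * (1 / (2 * τ) * ‖S‖) = (‖S‖ * (2 * |u| / τ)) / 4 := by ring
    _ ≤ 1 / 2 := by linarith

/-- A block of `m` consecutive frequencies has a kernel of height at most `A = m / (2τ)` that decays
like `1 / |u|`; both bounds at once. -/
lemma norm_blockKernel_Icc_le (a b : ℤ) {τ : ℝ} (hτ : 0 < τ) {u : ℝ} (hu : |u| ≤ τ) {A : ℝ}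
    (hA : ((Finset.Icc a b).card : ℝ) / (2 * τ) ≤ A) :
    ‖blockKernel (Finset.Icc a b) τ u‖ ≤ 3 / 2 * A * (1 + A * |u|)⁻¹ := by
  have h1 := (norm_blockKernel_le_card (Finset.Icc a b) hτ u).trans hA
  have h2 := abs_mul_norm_blockKernel_Icc_le a b hτ hu
  have hA0 : 0 ≤ A := (norm_nonneg _).trans h1
  rw [← div_eq_mul_inv, le_div_iff₀ (by positivity)]
  nlinarith

/-- The `q`-th power integral of the profile `(1 + |v|)⁻¹` dominating the rescaled kernels. -/
noncomputable def profileIntegral (q : ℝ) : ℝ := ∫ v : ℝ, (1 + ‖v‖) ^ (-q)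

lemma integral_norm_blockKernel_rpow_le {q : ℝ} (hq : 1 < q) (a b : ℤ) {τ : ℝ} (hτ : 0 < τ) {A : ℝ}
    (hA0 : 0 < A) (hA : ((Finset.Icc a b).card : ℝ) / (2 * τ) ≤ A) (x : ℝ) :
    ∫ t in (-τ)..τ, ‖blockKernel (Finset.Icc a b) τ (x - t)‖ ^ q ≤
      (3 / 2 * A) ^ q * (A⁻¹ * profileIntegral q) := by
  set G := blockKernel (Finset.Icc a b) τ
  have hper : Function.Periodic (fun u => ‖G u‖ ^ q) (2 * τ) := by
    intro u
    simp only [G, blockKernel_periodic _ hτ u]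
  have hcont : Continuous fun u => ‖G u‖ ^ q :=
    (blockKernel_continuous _ _).norm.rpow_const fun _ => Or.inr (by linarith)
  rw [intervalIntegral.integral_comp_sub_left (fun u => ‖G u‖ ^ q) x]
  -- by periodicity the integral over `[x - τ, x + τ]` is the one over `[-τ, τ]`
  have h1 := hper.intervalIntegral_add_eq (x - τ) (-τ)
  rw [show x - τ + 2 * τ = x - -τ by ring, show -τ + 2 * τ = τ by ring] at h1
  rw [h1]
  have hint : Integrable fun v : ℝ => (1 + ‖v‖) ^ (-q) :=
    integrable_one_add_norm (by simpa using hq)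
  have hint' : Integrable fun u : ℝ => (3 / 2 * A) ^ q * (1 + ‖A * u‖) ^ (-q) :=
    (hint.comp_mul_left' hA0.ne').const_mul _
  calc ∫ u in (-τ)..τ, ‖G u‖ ^ q
      ≤ ∫ u in (-τ)..τ, (3 / 2 * A) ^ q * (1 + ‖A * u‖) ^ (-q) := by
        refine intervalIntegral.integral_mono_on (by linarith) (hcont.intervalIntegrable _ _)
          hint'.intervalIntegrable fun u hu => ?_
        have h := norm_blockKernel_Icc_le a b hτ (abs_le.2 hu) hA
        have h0 : (0 : ℝ) ≤ 1 + A * |u| := by positivity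
        rw [norm_mul, Real.norm_of_nonneg hA0.le, Real.norm_eq_abs, Real.rpow_neg h0,
          ← Real.inv_rpow h0, ← Real.mul_rpow (by positivity) (by positivity)]
        exact Real.rpow_le_rpow (norm_nonneg _) h (by linarith)
    _ ≤ ∫ u : ℝ, (3 / 2 * A) ^ q * (1 + ‖A * u‖) ^ (-q) := by
        rw [intervalIntegral.integral_of_le (by linarith)]
        exact setIntegral_le_integral hint' (Eventually.of_forall fun u => by positivity)
    _ = _ := by
        rw [integral_const_mul, Measure.integral_comp_mul_left (fun v : ℝ => (1 + ‖v‖) ^ (-q)) A,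
          abs_of_pos (inv_pos.2 hA0), smul_eq_mul, profileIntegral]

/-- The constant in the uniform bound for blocks of frequencies on `L^p`; the argument `q` is the
exponent conjugate to `p`. -/
noncomputable def blockConst (q : ℝ) : ℝ := 3 / 2 * profileIntegral q ^ (1 / q)

lemma blockConst_nonneg (q : ℝ) : 0 ≤ blockConst q := by
  have : 0 ≤ profileIntegral q := integral_nonneg fun v => by positivity
  unfold blockConst
  positivity

lemma intervalIntegrable_of_memLp {p : ℝ≥0∞} [hp : Fact (1 ≤ p)] {f : ℝ → ℂ}
    (hf : MemLp f p volume) (a b : ℝ) : IntervalIntegrable f volume a b :=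
  ((hf.locallyIntegrable hp.out).integrableOn_isCompact isCompact_uIcc).intervalIntegrable

/-- A block of frequencies of relative length `A = m / (2τ)` defines an operator from `L^p` to `L^∞`
of norm `O(A^{1/p})`, uniformly in `τ` and in the position of the block. -/
theorem norm_blockSum_le {p : ℝ≥0∞} [Fact (1 ≤ p)] (hp₁ : 1 < p) (hp₂ : p < ∞)
    {f : ℝ → ℂ} (hf : MemLp f p volume) (a b : ℤ) {τ : ℝ} (hτ : 0 < τ) {A : ℝ}
    (hA0 : 0 < A) (hA : ((Finset.Icc a b).card : ℝ) / (2 * τ) ≤ A) (x : ℝ) :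
    ‖blockSum (Finset.Icc a b) f τ x‖ ≤
      blockConst p.toReal.conjExponent * A ^ (1 / p.toReal) * (eLpNorm f p volume).toReal := by
  have hP : 1 < p.toReal := by
    rw [← ENNReal.toReal_one]; exact (ENNReal.toReal_lt_toReal (by simp) hp₂.ne).2 hp₁
  have hp0 : p ≠ 0 := (zero_lt_one.trans hp₁).ne'
  set P := p.toReal with hPdef
  have hconj := Real.HolderConjugate.conjExponent hP
  set q := P.conjExponent
  have hq : 1 < q := hconj.symm.lt
  set G := blockKernel (Finset.Icc a b) τ with hG
  have hGc : Continuous G := blockKernel_continuous _ _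
  rw [blockSum_eq_integral _ (intervalIntegrable_of_memLp hf _ _),
    intervalIntegral.integral_of_le (by linarith)]
  have hPe : ENNReal.ofReal P = p := ENNReal.ofReal_toReal hp₂.ne
  have hfr : MemLp f (ENNReal.ofReal P) (volume.restrict (Set.Ioc (-τ) τ)) := by
    rw [hPe]; exact hf.restrict _
  have hGq : MemLp (fun t => G (x - t)) (ENNReal.ofReal q) (volume.restrict (Set.Ioc (-τ) τ)) := by
    refine MemLp.of_bound (hGc.comp (by fun_prop)).aestronglyMeasurable
      ((Finset.Icc a b).card / (2 * τ)) (Eventually.of_forall fun t => ?_)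
    exact norm_blockKernel_le_card _ hτ _
  have hH := integral_mul_norm_le_Lp_mul_Lq hconj hfr hGq
  have hF : (∫ t in Set.Ioc (-τ) τ, ‖f t‖ ^ P) ^ (1 / P) ≤ (eLpNorm f p volume).toReal := by
    rw [hf.eLpNorm_eq_integral_rpow_norm hp0 hp₂.ne, ENNReal.toReal_ofReal (by positivity),
      ← one_div]
    refine Real.rpow_le_rpow (integral_nonneg fun t => by positivity) ?_ (by positivity)
    exact setIntegral_le_integral (hf.integrable_norm_rpow hp0 hp₂.ne)
      (Eventually.of_forall fun u => by positivity)
  have hK : (∫ t in Set.Ioc (-τ) τ, ‖G (x - t)‖ ^ q) ^ (1 / q) ≤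
      blockConst q * A ^ (1 / P) := by
    have h1 := integral_norm_blockKernel_rpow_le hq a b hτ hA0 hA x
    rw [intervalIntegral.integral_of_le (by linarith)] at h1
    have hK0 : 0 ≤ profileIntegral q := integral_nonneg fun v => by positivity
    refine (Real.rpow_le_rpow (integral_nonneg fun t => by positivity) h1 (by positivity)).trans ?_
    rw [Real.mul_rpow (by positivity) (by positivity), Real.mul_rpow (by positivity) hK0,
      ← Real.rpow_mul (by positivity), mul_one_div_cancel (by linarith), Real.rpow_one, blockConst]
    have : A * A⁻¹ ^ (1 / q) = A ^ (1 / P) := by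
      rw [Real.inv_rpow hA0.le, ← Real.rpow_neg hA0.le]
      nth_rewrite 1 [← Real.rpow_one A]
      rw [← Real.rpow_add hA0]
      congr 1
      have := hconj.inv_add_inv_eq_one
      simp only [one_div]
      linarith
    rw [← this]
    apply le_of_eq
    ring
  calc ‖∫ t in Set.Ioc (-τ) τ, f t * G (x - t)‖
      ≤ ∫ t in Set.Ioc (-τ) τ, ‖f t‖ * ‖G (x - t)‖ := by
        refine (norm_integral_le_integral_norm _).trans (le_of_eq ?_)
        simp only [norm_mul]
    _ ≤ _ := hH
    _ ≤ (eLpNorm f p volume).toReal * (blockConst q * A ^ (1 / P)) := by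
        gcongr
    _ = _ := by ring

lemma blockSum_sub (s : Finset ℤ) {f g : ℝ → ℂ} {τ : ℝ} (hf : IntervalIntegrable f volume (-τ) τ)
    (hg : IntervalIntegrable g volume (-τ) τ) (x : ℝ) :
    blockSum s (fun t => f t - g t) τ x = blockSum s f τ x - blockSum s g τ x := by
  rw [blockSum_eq_integral _ hf, blockSum_eq_integral _ hg, blockSum_eq_integral _ (hf.sub hg)]
  have hc : Continuous fun t => blockKernel s τ (x - t) :=
    (blockKernel_continuous s τ).comp (by fun_prop)
  rw [← intervalIntegral.integral_sub (hf.mul_continuousOn hc.continuousOn)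
    (hg.mul_continuousOn hc.continuousOn)]
  simp only [sub_mul]

/-! ### Trigonometric sums of band-limited Schwartz functions -/

lemma norm_integral_sub_intervalIntegral_le {h : ℝ → ℂ} (hh : Integrable h) {τ : ℝ} (hτ : 0 ≤ τ) :
    ‖(∫ t, h t) - ∫ t in (-τ)..τ, h t‖ ≤ (∫ t, ‖h t‖) - ∫ t in (-τ)..τ, ‖h t‖ := by
  rw [intervalIntegral.integral_of_le (by linarith), intervalIntegral.integral_of_le (by linarith),
    ← integral_add_compl (measurableSet_Ioc (a := -τ) (b := τ)) hh,
    ← integral_add_compl (measurableSet_Ioc (a := -τ) (b := τ)) hh.norm, add_sub_cancel_left,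
    add_sub_cancel_left]
  exact norm_integral_le_integral_norm _

lemma fourier_comp_mul_left (f : ℝ → ℂ) {c : ℝ} (hc : 0 < c) (ξ : ℝ) :
    𝓕 (fun t => f (c * t)) ξ = (1 / (c : ℂ)) * 𝓕 f (ξ / c) := by
  rw [Real.fourier_real_eq_integral_exp_smul, Real.fourier_real_eq_integral_exp_smul]
  have := Measure.integral_comp_mul_left
    (fun v : ℝ => Complex.exp (↑(-2 * Real.pi * v * (ξ / c)) * Complex.I) • f v) c
  rw [abs_of_pos (inv_pos.2 hc)] at this
  rw [← Complex.ofReal_one, ← Complex.ofReal_div, one_div, ← Complex.real_smul, ← this]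
  congr 1
  ext t
  congr 4
  field_simp

/-- Poisson summation over the lattice `cℤ`. -/
lemma tsum_schwartz_translates (s : 𝓢(ℝ, ℂ)) {c : ℝ} (hc : 0 < c) (x : ℝ) :
    ∑' n : ℤ, s (x + c * n) =
      ∑' n : ℤ, (1 / (c : ℂ)) * 𝓕 s (n / c) * Complex.exp (2 * Real.pi * Complex.I * n * (x / c)) := by
  let e : ℝ ≃L[ℝ] ℝ := ContinuousLinearEquiv.unitsEquivAut ℝ (Units.mk0 c hc.ne')
  let s' : 𝓢(ℝ, ℂ) := SchwartzMap.compCLMOfContinuousLinearEquiv ℂ e s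
  have hs' : ∀ t, s' t = s (c * t) := by
    intro t
    simp [s', e, mul_comm]
  have h := SchwartzMap.tsum_eq_tsum_fourier s' (x / c)
  have h1 : ∀ n : ℤ, s' (x / c + n) = s (x + c * n) := by
    intro n
    rw [hs', mul_add, mul_div_cancel₀ _ hc.ne']
  simp_rw [h1] at h
  rw [h]
  refine tsum_congr fun n => ?_
  have h2 : 𝓕 s' (n : ℝ) = (1 / (c : ℂ)) * 𝓕 s (n / c) := by
    rw [SchwartzMap.fourier_coe, show (s' : ℝ → ℂ) = fun t => s (c * t) from funext hs',
      fourier_comp_mul_left _ hc, SchwartzMap.fourier_coe]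
  rw [h2, fourier_coe_apply]
  push_cast
  simp

/-- If `s` is `O(|y|⁻²)`, its `2τ`-periodization is `O(τ⁻²)`-close to `s` on `[-τ, τ]`. The sum on the
right runs over all integers: its term at `0` is `1 / 0 = 0`. -/
lemma norm_tsum_translates_sub_le {s : ℝ → ℂ} {C : ℝ} (hC : ∀ y, |y| ^ 2 * ‖s y‖ ≤ C)
    {τ : ℝ} (hτ : 0 < τ) {x : ℝ} (hx : |x| ≤ τ) :
    ‖(∑' n : ℤ, s (x + 2 * τ * n)) - s x‖ ≤ C / τ ^ 2 * ∑' n : ℤ, 1 / (n : ℝ) ^ 2 := by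
  have hsum : Summable fun n : ℤ => 1 / (n : ℝ) ^ 2 :=
    Real.summable_one_div_int_pow.2 one_lt_two
  have hterm : ∀ n : ℤ, n ≠ 0 → ‖s (x + 2 * τ * n)‖ ≤ C / τ ^ 2 * (1 / (n : ℝ) ^ 2) := by
    intro n hn
    have hn1 : (1 : ℝ) ≤ |(n : ℝ)| := by
      rw [← Int.cast_abs]; exact_mod_cast Int.one_le_abs hn
    have h1 : τ * |(n : ℝ)| ≤ |x + 2 * τ * n| := by
      have h2 : |2 * τ * n| - |x| ≤ |x + 2 * τ * n| := by
        have := abs_sub_abs_le_abs_sub (2 * τ * n) (-x)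
        rwa [abs_neg, sub_neg_eq_add, add_comm (2 * τ * (n : ℝ))] at this
      rw [abs_mul, abs_of_pos (by linarith : 0 < 2 * τ)] at h2
      nlinarith
    have h0 : 0 < τ * |(n : ℝ)| := by positivity
    rw [div_mul_div_comm, mul_one, le_div_iff₀ (by have : (n : ℝ) ≠ 0 := by exact_mod_cast hn
                                                   positivity), mul_comm]
    refine le_trans ?_ (hC (x + 2 * τ * n))
    gcongr
    rw [← sq_abs (n : ℝ), ← mul_pow]
    gcongr
  have hbound : ∀ n : ℤ, ‖s (x + 2 * τ * n) - if n = 0 then s x else 0‖ ≤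
      C / τ ^ 2 * (1 / (n : ℝ) ^ 2) := by
    intro n
    by_cases hn : n = 0
    · simp [hn]
    · simpa [hn] using hterm n hn
  have hS := hsum.mul_left (C / τ ^ 2)
  have hs0 : HasSum (fun n : ℤ => if n = 0 then s x else 0) (s x) := by
    simpa using hasSum_ite_eq (0 : ℤ) (s x)
  have hs1 : Summable fun n : ℤ => s (x + 2 * τ * n) := by
    have := (Summable.of_norm_bounded hS hbound).add hs0.summable
    simpa using this
  have := tsum_of_norm_bounded (hS.hasSum) hbound
  rw [hs1.tsum_sub hs0.summable, hs0.tsum_eq, tsum_mul_left] at this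
  exact this

/-- The coefficients over `[-τ, τ]` differ from the samples of the Fourier transform by at most the
`L¹` mass of `s` off `[-τ, τ]`. -/
lemma norm_expCoeff_sub_fourier_le (s : 𝓢(ℝ, ℂ)) {τ : ℝ} (hτ : 0 < τ) (k : ℤ) :
    ‖expCoeff s τ k - (1 / (2 * (τ : ℂ))) * 𝓕 s (k / (2 * τ))‖ ≤
      1 / (2 * τ) * ((∫ t, ‖s t‖) - ∫ t in (-τ)..τ, ‖s t‖) := by
  set h : ℝ → ℂ := fun t => s t * Complex.exp (-(Complex.I * (Real.pi / τ) * k * t)) with hh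
  have hnorm : ∀ t, ‖h t‖ = ‖s t‖ := by
    intro t
    rw [hh, norm_mul, Complex.exp_neg, norm_inv, norm_exp_frequency, inv_one, mul_one]
  have hint : Integrable h := by
    refine s.integrable.norm.mono' ?_ (Eventually.of_forall fun t => (hnorm t).le)
    exact (s.continuous.mul (by fun_prop)).aestronglyMeasurable
  have hF : 𝓕 s (k / (2 * τ)) = ∫ t, h t := by
    rw [SchwartzMap.fourier_coe, Real.fourier_real_eq_integral_exp_smul]
    congr 1
    ext t
    rw [smul_eq_mul, mul_comm, hh]
    congr 2
    push_cast
    field_simp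
  have := norm_integral_sub_intervalIntegral_le hint hτ.le
  simp_rw [hnorm] at this
  rw [hF, expCoeff, ← mul_sub, norm_mul, norm_sub_rev]
  have h1 := norm_one_div_two_mul hτ
  rw [h1]
  gcongr

/-- Number of frequencies in the trigonometric sum, relative to the period. -/
lemma card_Icc_neg_floor_div_le {σ : ℝ} (hσ : 0 ≤ σ) {τ : ℝ} (hτ : 1 ≤ τ) :
    ((Finset.Icc (-⌊σ * τ / Real.pi⌋) ⌊σ * τ / Real.pi⌋).card : ℝ) / (2 * τ) ≤ σ / Real.pi + 1 := by
  have hN : 0 ≤ ⌊σ * τ / Real.pi⌋ := Int.floor_nonneg.2 (by positivity)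
  have hle := Int.floor_le (σ * τ / Real.pi)
  rw [Int.card_Icc, div_le_iff₀ (by linarith)]
  have : (((⌊σ * τ / Real.pi⌋ + 1 - -⌊σ * τ / Real.pi⌋).toNat : ℕ) : ℝ) =
      2 * (⌊σ * τ / Real.pi⌋ : ℝ) + 1 := by
    rw [← Int.cast_natCast, Int.toNat_of_nonneg (by omega)]
    push_cast
    ring
  rw [this]
  have h2 : (σ / Real.pi + 1) * (2 * τ) = 2 * (σ * τ / Real.pi) + 2 * τ := by ring
  rw [h2]
  linarith

lemma norm_trigSum_schwartz_sub_le {σ : ℝ} (hσ : 0 ≤ σ) (s : 𝓢(ℝ, ℂ))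
    (hs : ∀ ξ : ℝ, σ / (2 * Real.pi) < |ξ| → 𝓕 s ξ = 0) {C : ℝ} (hC : ∀ y, |y| ^ 2 * ‖s y‖ ≤ C)
    {τ : ℝ} (hτ : 1 ≤ τ) {x : ℝ} (hx : |x| ≤ τ) :
    ‖trigSum σ s τ x - s x‖ ≤ (σ / Real.pi + 1) * ((∫ t, ‖s t‖) - ∫ t in (-τ)..τ, ‖s t‖) +
      C / τ ^ 2 * ∑' n : ℤ, 1 / (n : ℝ) ^ 2 := by
  have hτ0 : 0 < τ := by linarith
  set N := ⌊σ * τ / Real.pi⌋ with hN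
  have hN0 : 0 ≤ N := Int.floor_nonneg.2 (by positivity)
  -- the dual side of Poisson's formula is a finite sum over the frequencies of the trigonometric sum
  have hP : ∑' n : ℤ, s (x + 2 * τ * n) = ∑ k ∈ Finset.Icc (-N) N,
      (1 / (2 * (τ : ℂ))) * 𝓕 s (k / (2 * τ)) *
        Complex.exp (Complex.I * (Real.pi / τ) * k * x) := by
    rw [tsum_schwartz_translates s (by linarith : 0 < 2 * τ), tsum_eq_sum (s := Finset.Icc (-N) N)]
    · refine Finset.sum_congr rfl fun k _ => ?_
      have hτ' : (τ : ℂ) ≠ 0 := by exact_mod_cast hτ0.ne'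
      push_cast
      congr 2
      field_simp
    · intro k hk
      have hk' : N + 1 ≤ |k| := by
        by_contra hlt
        exact hk (Finset.mem_Icc.2 (abs_le.1 (by omega)))
      have h1 : σ * τ / Real.pi < |(k : ℝ)| := by
        refine (Int.lt_floor_add_one _).trans_le ?_
        rw [← Int.cast_abs]
        exact_mod_cast hk'
      rw [hs]
      · simp
      · rw [abs_div, abs_of_pos (by linarith : 0 < 2 * τ), lt_div_iff₀ (by linarith)]
        refine lt_of_eq_of_lt ?_ h1
        field_simp
  have hA := norm_tsum_translates_sub_le hC hτ0 hx
  have hT : 0 ≤ (∫ t, ‖s t‖) - ∫ t in (-τ)..τ, ‖s t‖ :=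
    (norm_nonneg _).trans (norm_integral_sub_intervalIntegral_le s.integrable hτ0.le)
  have hB : ‖trigSum σ s τ x - ∑' n : ℤ, s (x + 2 * τ * n)‖ ≤
      (σ / Real.pi + 1) * ((∫ t, ‖s t‖) - ∫ t in (-τ)..τ, ‖s t‖) := by
    rw [hP, trigSum, ← Finset.sum_sub_distrib]
    calc _ ≤ ∑ k ∈ Finset.Icc (-N) N,
          1 / (2 * τ) * ((∫ t, ‖s t‖) - ∫ t in (-τ)..τ, ‖s t‖) := by
          refine norm_sum_le_of_le _ fun k _ => ?_
          rw [← sub_mul, norm_mul, norm_exp_frequency, mul_one]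
          exact norm_expCoeff_sub_fourier_le s hτ0 k
      _ = (Finset.Icc (-N) N).card / (2 * τ) * ((∫ t, ‖s t‖) - ∫ t in (-τ)..τ, ‖s t‖) := by
          rw [Finset.sum_const, nsmul_eq_mul]; ring
      _ ≤ _ := by
          gcongr
          exact card_Icc_neg_floor_div_le hσ hτ
  calc _ = ‖(trigSum σ s τ x - ∑' n : ℤ, s (x + 2 * τ * n)) +
        ((∑' n : ℤ, s (x + 2 * τ * n)) - s x)‖ := by congr 1; ring
    _ ≤ _ := (norm_add_le _ _).trans (add_le_add hB hA)

/-- Uniform convergence for band-limited Schwartz functions: by Poisson summation the trigonometric sum is, up to an error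
controlled by the `L¹` mass of `s` off `[-τ, τ]`, the `2τ`-periodization of `s`. -/
theorem tendstoUniformly_truncTrigSum_schwartz {σ : ℝ} (hσ : 0 ≤ σ) (s : 𝓢(ℝ, ℂ))
    (hs : ∀ ξ : ℝ, σ / (2 * Real.pi) < |ξ| → 𝓕 s ξ = 0) :
    TendstoUniformly (fun τ : ℝ => truncTrigSum σ s τ) s atTop := by
  obtain ⟨C, hC0, hC⟩ : ∃ C, 0 < C ∧ ∀ y, |y| ^ 2 * ‖s y‖ ≤ C := by
    obtain ⟨C, h0, h⟩ := s.decay 2 0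
    exact ⟨C, h0, fun y => by simpa using h y⟩
  set Z := ∑' n : ℤ, 1 / (n : ℝ) ^ 2
  have hZ : 0 ≤ Z := tsum_nonneg fun n => by positivity
  set T : ℝ → ℝ := fun τ => (∫ t, ‖s t‖) - ∫ t in (-τ)..τ, ‖s t‖ with hTdef
  have hT : Tendsto T atTop (𝓝 0) := by
    have := (intervalIntegral_tendsto_integral (s.integrable (μ := volume)).norm tendsto_neg_atTop_atBot
      tendsto_id).const_sub (∫ t, ‖s t‖)
    simpa using this
  have hlim : Tendsto (fun τ : ℝ => (σ / Real.pi + 1) * T τ + C / τ ^ 2 * (Z + 1)) atTop (𝓝 0) := by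
    have h2 : Tendsto (fun τ : ℝ => C / τ ^ 2) atTop (𝓝 0) :=
      tendsto_const_nhds.div_atTop (tendsto_pow_atTop two_ne_zero)
    simpa using (hT.const_mul (σ / Real.pi + 1)).add (h2.mul_const (Z + 1))
  rw [Metric.tendstoUniformly_iff]
  intro ε hε
  filter_upwards [hlim.eventually_lt_const hε, eventually_ge_atTop 1] with τ hτε hτ x
  refine lt_of_le_of_lt ?_ hτε
  have hτ0 : 0 < τ := by linarith
  have hT0 : 0 ≤ T τ :=
    (norm_nonneg _).trans (norm_integral_sub_intervalIntegral_le s.integrable hτ0.le)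
  rw [dist_comm, dist_eq_norm, truncTrigSum]
  by_cases hx : x ∈ Set.Icc (-τ) τ
  · rw [Set.indicator_of_mem hx]
    refine (norm_trigSum_schwartz_sub_le hσ s hs hC hτ (abs_le.2 hx)).trans ?_
    have : C / τ ^ 2 * Z ≤ C / τ ^ 2 * (Z + 1) := by gcongr; linarith
    linarith
  · rw [Set.indicator_of_notMem hx, zero_sub, norm_neg]
    have hx' : τ < |x| := by
      by_contra h
      exact hx (abs_le.1 (not_lt.1 h))
    have h1 : ‖s x‖ ≤ C / τ ^ 2 := by
      rw [le_div_iff₀ (by positivity), mul_comm]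
      refine le_trans ?_ (hC x)
      gcongr
    have h2 : 0 ≤ (σ / Real.pi + 1) * T τ := by positivity
    have h3 : 0 ≤ C / τ ^ 2 * Z := by positivity
    linarith

/-! ### Density of band-limited Schwartz functions in the Bernstein space -/

/-- Young's inequality for convolutions with an integrable function: `‖a ⋆ b‖_p ≤ ‖a‖_1 ‖b‖_p`. -/
lemma eLpNorm_convolution_le {p : ℝ≥0∞} (hp₁ : 1 < p) (hp₂ : p < ∞) {a b : ℝ → ℂ}
    (ha : Continuous a) (hb : Continuous b) :
    eLpNorm (fun x => ∫ t, a t * b (x - t)) p volume ≤ eLpNorm a 1 volume * eLpNorm b p volume := by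
  have hP : 1 < p.toReal := by
    rw [← ENNReal.toReal_one]; exact (ENNReal.toReal_lt_toReal (by simp) hp₂.ne).2 hp₁
  have hp0 : p ≠ 0 := (zero_lt_one.trans hp₁).ne'
  set P := p.toReal with hPdef
  have hP0 : 0 < P := by linarith
  have hconj := Real.HolderConjugate.conjExponent hP
  set q := P.conjExponent
  set ν : Measure ℝ := volume.withDensity fun t => ‖a t‖ₑ with hν
  have hν1 : ν Set.univ = eLpNorm a 1 volume := by
    rw [hν, withDensity_apply _ MeasurableSet.univ, Measure.restrict_univ,
      eLpNorm_one_eq_lintegral_enorm]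
  have hbm : Measurable fun z : ℝ × ℝ => ‖b (z.1 - z.2)‖ₑ ^ P :=
    ((hb.comp (by fun_prop)).enorm.measurable).pow_const _
  -- Hölder's inequality against the measure `|a(t)| dt`
  have hpt : ∀ x, ‖∫ t, a t * b (x - t)‖ₑ ^ P ≤
      (∫⁻ t, ‖b (x - t)‖ₑ ^ P ∂ν) * ν Set.univ ^ (P - 1) := by
    intro x
    have hbx : Measurable fun t => ‖b (x - t)‖ₑ := (hb.comp (by fun_prop)).enorm.measurable
    have h1 : ‖∫ t, a t * b (x - t)‖ₑ ≤ ∫⁻ t, ‖b (x - t)‖ₑ ∂ν := by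
      refine (enorm_integral_le_lintegral_enorm _).trans (le_of_eq ?_)
      rw [hν, lintegral_withDensity_eq_lintegral_mul _ ha.enorm.measurable hbx]
      simp only [enorm_mul, Pi.mul_apply]
    have h2 := ENNReal.lintegral_mul_le_Lp_mul_Lq ν hconj hbx.aemeasurable
      (aemeasurable_const (b := (1 : ℝ≥0∞)))
    simp only [Pi.mul_apply, mul_one, ENNReal.one_rpow, lintegral_const, one_mul] at h2
    calc _ ≤ ((∫⁻ t, ‖b (x - t)‖ₑ ^ P ∂ν) ^ (1 / P) * ν Set.univ ^ (1 / q)) ^ P := by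
          gcongr
          exact h1.trans h2
      _ = _ := by
          rw [ENNReal.mul_rpow_of_nonneg _ _ hP0.le, ← ENNReal.rpow_mul, ← ENNReal.rpow_mul,
            one_div_mul_cancel hP0.ne', ENNReal.rpow_one]
          congr 2
          have h3 := hconj.inv_add_inv_eq_one
          have h4 : 1 / q = 1 - P⁻¹ := by rw [one_div]; linarith
          rw [h4]
          field_simp
  rw [eLpNorm_eq_lintegral_rpow_enorm_toReal hp0 hp₂.ne,
    eLpNorm_eq_lintegral_rpow_enorm_toReal hp0 hp₂.ne, ← hν1]
  calc (∫⁻ x, ‖∫ t, a t * b (x - t)‖ₑ ^ P) ^ (1 / P)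
      ≤ (∫⁻ x, (∫⁻ t, ‖b (x - t)‖ₑ ^ P ∂ν) * ν Set.univ ^ (P - 1)) ^ (1 / P) := by
        gcongr with x
        exact hpt x
    _ = ((∫⁻ y, ‖b y‖ₑ ^ P) * ν Set.univ * ν Set.univ ^ (P - 1)) ^ (1 / P) := by
        rw [lintegral_mul_const _ hbm.lintegral_prod_right', lintegral_lintegral_swap hbm.aemeasurable]
        have : ∀ t, ∫⁻ x, ‖b (x - t)‖ₑ ^ P = ∫⁻ y, ‖b y‖ₑ ^ P := fun t =>
          lintegral_sub_right_eq_self (fun y => ‖b y‖ₑ ^ P) t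
        simp_rw [this]
        rw [lintegral_const]
    _ = ν Set.univ * (∫⁻ y, ‖b y‖ₑ ^ P) ^ (1 / P) := by
        have : ν Set.univ * ν Set.univ ^ (P - 1) = ν Set.univ ^ P := by
          nth_rewrite 1 [← ENNReal.rpow_one (ν Set.univ)]
          rw [← ENNReal.rpow_add_of_nonneg _ _ zero_le_one (by linarith)]
          congr 1
          ring
        rw [mul_assoc, this, ENNReal.mul_rpow_of_nonneg _ _ (by positivity), ← ENNReal.rpow_mul,
          mul_one_div_cancel hP0.ne', ENNReal.rpow_one, mul_comm]

/-- A Fourier multiplier with Schwartz symbol is bounded on Schwartz functions in the `L^p` norm,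
being convolution with an integrable function. -/
lemma exists_norm_toLp_fourierMultiplierCLM_le {p : ℝ≥0∞} [Fact (1 ≤ p)] (hp₁ : 1 < p)
    (hp₂ : p < ∞) (m : 𝓢(ℝ, ℂ)) :
    ∃ K : ℝ, 0 ≤ K ∧ ∀ s : 𝓢(ℝ, ℂ),
      ‖(SchwartzMap.fourierMultiplierCLM ℂ m s).toLp p volume‖ ≤ K * ‖s.toLp p volume‖ := by
  obtain ⟨k, hk⟩ : ∃ k : 𝓢(ℝ, ℂ), 𝓕 k = m := ⟨𝓕⁻ m, FourierTransform.fourier_fourierInv_eq m⟩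
  refine ⟨(eLpNorm k 1 volume).toReal, ENNReal.toReal_nonneg, fun s => ?_⟩
  have hconv : ∀ x, SchwartzMap.fourierMultiplierCLM ℂ m s x = ∫ t, k t * s (x - t) := by
    intro x
    have h1 : SchwartzMap.fourierMultiplierCLM ℂ m s =
        SchwartzMap.convolution (ContinuousLinearMap.mul ℂ ℂ) k s := by
      have h2 : SchwartzMap.smulLeftCLM ℂ m (𝓕 s) =
          𝓕 (SchwartzMap.convolution (ContinuousLinearMap.mul ℂ ℂ) k s) := by
        rw [SchwartzMap.fourier_convolution, hk]
        ext ξ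
        simp [SchwartzMap.smulLeftCLM_apply_apply m.hasTemperateGrowth]
      rw [SchwartzMap.fourierMultiplierCLM_apply, h2, FourierTransform.fourierInv_fourier_eq]
    rw [h1, SchwartzMap.convolution_apply]
    rfl
  rw [SchwartzMap.norm_toLp, SchwartzMap.norm_toLp, ← ENNReal.toReal_mul]
  have hk1 : eLpNorm k 1 volume ≠ ∞ := (k.memLp 1 volume).eLpNorm_ne_top
  have hsp : eLpNorm s p volume ≠ ∞ := (s.memLp p volume).eLpNorm_ne_top
  refine ENNReal.toReal_mono (ENNReal.mul_ne_top hk1 hsp) ?_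
  rw [show (SchwartzMap.fourierMultiplierCLM ℂ m s : ℝ → ℂ) = _ from funext hconv]
  exact eLpNorm_convolution_le hp₁ hp₂ k.continuous s.continuous

/-- A smooth symbol that equals `1` near the spectrum does not change a band-limited distribution. -/
lemma fourierMultiplierCLM_eq_self {F : 𝓢'(ℝ, ℂ)} {r : ℝ} (m : 𝓢(ℝ, ℂ))
    (hm : ∃ r' > r, ∀ ξ : ℝ, |ξ| ≤ r' → m ξ = 1)
    (hF : Distribution.IsVanishingOn (𝓕 F : 𝓢'(ℝ, ℂ)) (Set.Icc (-r) r)ᶜ) :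
    TemperedDistribution.fourierMultiplierCLM ℂ m F = F := by
  ext u
  obtain ⟨r', hr', hm⟩ := hm
  rw [TemperedDistribution.fourierMultiplierCLM_apply_apply]
  set v : 𝓢(ℝ, ℂ) := SchwartzMap.smulLeftCLM ℂ m (𝓕⁻ u) - 𝓕⁻ u with hv
  have hsupp : tsupport v ⊆ (Set.Icc (-r) r)ᶜ := by
    have h1 : tsupport v ⊆ {ξ | r' ≤ |ξ|} := by
      refine closure_minimal (fun ξ hξ => ?_) (isClosed_le continuous_const continuous_abs)
      by_contra hlt
      rw [Set.mem_ofPred_eq, not_le] at hlt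
      refine hξ ?_
      rw [hv]
      simp [SchwartzMap.smulLeftCLM_apply_apply m.hasTemperateGrowth, hm ξ hlt.le]
    refine h1.trans fun ξ hξ hmem => ?_
    have := abs_le.2 hmem
    rw [Set.mem_ofPred_eq] at hξ
    linarith
  have h := hF v hsupp
  rw [TemperedDistribution.fourier_apply, hv] at h
  have h2 : 𝓕 (SchwartzMap.smulLeftCLM ℂ m (𝓕⁻ u) - 𝓕⁻ u) =
      𝓕 (SchwartzMap.smulLeftCLM ℂ m (𝓕⁻ u)) - u := by
    rw [← FourierTransform.fourierCLM_apply (R := ℂ), map_sub, FourierTransform.fourierCLM_apply,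
      FourierTransform.fourierCLM_apply, FourierTransform.fourier_fourierInv_eq]
  rw [h2, map_sub, sub_eq_zero] at h
  exact h

/-- Every function in the Bernstein space of bandwidth `σ` is an `L^p` limit of Schwartz functions of
any larger bandwidth `σ'`. -/
theorem exists_bandlimited_schwartz_tendsto {σ σ' : ℝ} (hσ : 0 ≤ σ) (hσ' : σ < σ') {p : ℝ≥0∞}
    [Fact (1 ≤ p)] (hp₁ : 1 < p) (hp₂ : p < ∞) {f : Lp ℂ p (volume : Measure ℝ)}
    (hf : f ∈ bernsteinSpace σ p) :
    ∃ s : ℕ → 𝓢(ℝ, ℂ), (∀ n, ∀ ξ : ℝ, σ' / (2 * Real.pi) < |ξ| → 𝓕 (s n) ξ = 0) ∧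
      Tendsto (fun n => (s n).toLp p volume) atTop (𝓝 f) := by
  set r := σ / (2 * Real.pi) with hr
  set r' := σ' / (2 * Real.pi) with hr'
  have hr0 : 0 ≤ r := by positivity
  have hrr : r < r' := by rw [hr, hr']; gcongr
  let χ : ContDiffBump (0 : ℝ) := ⟨(r + r') / 2, r', by linarith, by linarith⟩
  have hc : HasCompactSupport (Complex.ofRealCLM ∘ χ) := χ.hasCompactSupport.comp_left rfl
  have hd : ContDiff ℝ (⊤ : ℕ∞) (Complex.ofRealCLM ∘ χ) :=
    Complex.ofRealCLM.contDiff.comp χ.contDiff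
  let m : 𝓢(ℝ, ℂ) := hc.toSchwartzMap hd
  have hmval : ∀ ξ, m ξ = (χ ξ : ℂ) := fun ξ => rfl
  have hm1 : ∃ r'' > r, ∀ ξ : ℝ, |ξ| ≤ r'' → m ξ = 1 := by
    refine ⟨(r + r') / 2, by linarith, fun ξ hξ => ?_⟩
    rw [hmval, χ.one_of_mem_closedBall, Complex.ofReal_one]
    simpa using hξ
  have hm0 : ∀ ξ : ℝ, r' < |ξ| → m ξ = 0 := by
    intro ξ hξ
    rw [hmval, χ.zero_of_le_dist, Complex.ofReal_zero]
    simpa using hξ.le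
  set T := SchwartzMap.fourierMultiplierCLM ℂ (m : ℝ → ℂ) with hT
  obtain ⟨K, hK0, hK⟩ := exists_norm_toLp_fourierMultiplierCLM_le hp₁ hp₂ m
  obtain ⟨t, htmem, ht⟩ := mem_closure_iff_seq_limit.1
    (SchwartzMap.denseRange_toLpCLM (E := ℝ) (F := ℂ) (μ := volume) hp₂.ne f)
  choose u hu using htmem
  have hu' : ∀ n, (u n).toLp p volume = t n := hu
  have hcauchy : CauchySeq fun n => (T (u n)).toLp p volume := by
    rw [Metric.cauchySeq_iff']
    intro ε hε
    obtain ⟨N, hN⟩ := Metric.cauchySeq_iff'.1 ht.cauchySeq (ε / (K + 1)) (by positivity)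
    refine ⟨N, fun n hn => ?_⟩
    have h1 := hN n hn
    rw [dist_eq_norm, lt_div_iff₀ (by positivity)] at h1
    have hsub : ∀ a b : 𝓢(ℝ, ℂ), a.toLp p volume - b.toLp p volume = (a - b).toLp p volume :=
      fun a b => (map_sub (SchwartzMap.toLpCLM ℝ ℂ p volume) a b).symm
    rw [dist_eq_norm, hsub, ← map_sub]
    refine (hK _).trans_lt ?_
    rw [← hsub, hu', hu']
    nlinarith [norm_nonneg (t n - t N)]
  obtain ⟨h, hh⟩ := cauchySeq_tendsto_of_complete hcauchy
  -- the limit is identified in the sense of distributions, where the multiplier fixes `f`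
  have hhf : h = f := by
    have hinj : Function.Injective (Lp.toTemperedDistributionCLM ℂ (volume : Measure ℝ) p) :=
      LinearMap.ker_eq_bot.1 Lp.ker_toTemperedDistributionCLM_eq_bot
    apply hinj
    have h1 : Tendsto (fun n => Lp.toTemperedDistributionCLM ℂ volume p ((T (u n)).toLp p volume))
        atTop (𝓝 (Lp.toTemperedDistributionCLM ℂ volume p h)) :=
      ((Lp.toTemperedDistributionCLM ℂ volume p).continuous.tendsto h).comp hh
    have h2 : Tendsto (fun n => TemperedDistribution.fourierMultiplierCLM ℂ m
        (Lp.toTemperedDistributionCLM ℂ volume p (t n))) atTop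
        (𝓝 (TemperedDistribution.fourierMultiplierCLM ℂ m
          (Lp.toTemperedDistributionCLM ℂ volume p f))) :=
      (((TemperedDistribution.fourierMultiplierCLM ℂ m).continuous.comp
        (Lp.toTemperedDistributionCLM ℂ volume p).continuous).tendsto f).comp ht
    rw [Lp.toTemperedDistributionCLM_apply f, fourierMultiplierCLM_eq_self m hm1 (r := r) hf] at h2
    refine tendsto_nhds_unique (h1.congr fun n => ?_) h2
    rw [← hu', Lp.toTemperedDistributionCLM_apply, Lp.toTemperedDistributionCLM_apply,
      Lp.toTemperedDistribution_toLp_eq, Lp.toTemperedDistribution_toLp_eq,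
      TemperedDistribution.fourierMultiplierCLM_toTemperedDistributionCLM_eq m.hasTemperateGrowth]
  refine ⟨fun n => T (u n), fun n ξ hξ => ?_, hhf ▸ hh⟩
  change 𝓕 (SchwartzMap.fourierMultiplierCLM ℂ m (u n)) ξ = 0
  rw [SchwartzMap.fourierMultiplierCLM_apply, FourierTransform.fourier_fourierInv_eq,
    SchwartzMap.smulLeftCLM_apply_apply m.hasTemperateGrowth, hm0 ξ hξ, zero_smul]

/-! ### Uniform bounds for the trigonometric sums -/

/-- For fixed bandwidth the operators `f ↦ f_τ` are bounded from `L^p` to `L^∞` uniformly in `τ`. -/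
lemma exists_norm_trigSum_le {σ : ℝ} (hσ : 0 ≤ σ) {p : ℝ≥0∞} [Fact (1 ≤ p)] (hp₁ : 1 < p)
    (hp₂ : p < ∞) :
    ∃ C : ℝ, 0 ≤ C ∧ ∀ h : ℝ → ℂ, MemLp h p volume → ∀ τ : ℝ, 1 ≤ τ → ∀ x,
      ‖trigSum σ h τ x‖ ≤ C * (eLpNorm h p volume).toReal := by
  refine ⟨blockConst p.toReal.conjExponent * (σ / Real.pi + 1) ^ (1 / p.toReal),
    mul_nonneg (blockConst_nonneg _) (by positivity), fun h hh τ hτ x => ?_⟩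
  rw [trigSum_eq_blockSum]
  exact norm_blockSum_le hp₁ hp₂ hh _ _ (by linarith) (by positivity)
    (card_Icc_neg_floor_div_le hσ hτ) x

lemma card_Icc_floor_div_le {σ σ' : ℝ} (hσ : σ ≤ σ') {τ : ℝ} (hτ : 0 < τ) :
    ((Finset.Icc (⌊σ * τ / Real.pi⌋ + 1) ⌊σ' * τ / Real.pi⌋).card : ℝ) / (2 * τ) ≤
      (σ' - σ) / (2 * Real.pi) + 1 / (2 * τ) := by
  have hNN : ⌊σ * τ / Real.pi⌋ ≤ ⌊σ' * τ / Real.pi⌋ := Int.floor_le_floor (by gcongr)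
  rw [Int.card_Icc, div_le_iff₀ (by linarith)]
  have : (((⌊σ' * τ / Real.pi⌋ + 1 - (⌊σ * τ / Real.pi⌋ + 1)).toNat : ℕ) : ℝ) =
      (⌊σ' * τ / Real.pi⌋ : ℝ) - ⌊σ * τ / Real.pi⌋ := by
    rw [← Int.cast_natCast, Int.toNat_of_nonneg (by omega)]
    push_cast
    ring
  rw [this]
  have h1 := Int.floor_le (σ' * τ / Real.pi)
  have h2 := Int.lt_floor_add_one (σ * τ / Real.pi)
  have h3 : ((σ' - σ) / (2 * Real.pi) + 1 / (2 * τ)) * (2 * τ) =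
      σ' * τ / Real.pi - σ * τ / Real.pi + 1 := by
    field_simp
  rw [h3]
  linarith

/-- Enlarging the bandwidth slightly changes the trigonometric sums little, uniformly in `τ`: the
additional frequencies form two short blocks. -/
lemma norm_trigSum_sub_trigSum_le {σ σ' : ℝ} (hσ : 0 ≤ σ) (hσ' : σ ≤ σ') {p : ℝ≥0∞}
    [Fact (1 ≤ p)] (hp₁ : 1 < p) (hp₂ : p < ∞) {f : ℝ → ℂ} (hf : MemLp f p volume) {τ : ℝ}
    (hτ : 0 < τ) {A : ℝ} (hA0 : 0 < A)
    (hA : (σ' - σ) / (2 * Real.pi) + 1 / (2 * τ) ≤ A) (x : ℝ) :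
    ‖trigSum σ f τ x - trigSum σ' f τ x‖ ≤
      2 * (blockConst p.toReal.conjExponent * A ^ (1 / p.toReal) *
        (eLpNorm f p volume).toReal) := by
  have hcard := (card_Icc_floor_div_le hσ' hτ).trans hA
  have hN0 : 0 ≤ ⌊σ * τ / Real.pi⌋ := Int.floor_nonneg.2 (by positivity)
  have hNN : ⌊σ * τ / Real.pi⌋ ≤ ⌊σ' * τ / Real.pi⌋ := Int.floor_le_floor (by gcongr)
  rw [trigSum_eq_blockSum, trigSum_eq_blockSum]
  set N := ⌊σ * τ / Real.pi⌋
  set N' := ⌊σ' * τ / Real.pi⌋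
  have hsplit : blockSum (Finset.Icc (-N') N') f τ x = blockSum (Finset.Icc (-N) N) f τ x +
      (blockSum (Finset.Icc (-N') (-(N + 1))) f τ x + blockSum (Finset.Icc (N + 1) N') f τ x) := by
    unfold blockSum
    rw [← Finset.sum_union, ← Finset.sum_union]
    · refine Finset.sum_congr ?_ fun _ _ => rfl
      ext k
      simp only [Finset.mem_union, Finset.mem_Icc]
      omega
    · refine Finset.disjoint_left.2 fun k hk hk' => ?_
      simp only [Finset.mem_union, Finset.mem_Icc] at hk hk'
      omega
    · refine Finset.disjoint_left.2 fun k hk hk' => ?_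
      simp only [Finset.mem_Icc] at hk hk'
      omega
  have hcard' : ((Finset.Icc (-N') (-(N + 1))).card : ℝ) / (2 * τ) ≤ A := by
    have : (Finset.Icc (-N') (-(N + 1))).card = (Finset.Icc (N + 1) N').card := by
      rw [Int.card_Icc, Int.card_Icc]
      congr 1
      ring
    rwa [this]
  rw [hsplit, sub_add_cancel_left, norm_neg, two_mul]
  exact (norm_add_le _ _).trans (add_le_add (norm_blockSum_le hp₁ hp₂ hf _ _ hτ hA0 hcard' x)
    (norm_blockSum_le hp₁ hp₂ hf _ _ hτ hA0 hcard x))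

/-- Nikolskii's inequality `‖s‖_∞ ≤ C ‖s‖_p` for Schwartz functions of a given bandwidth. -/
lemma exists_norm_bandlimited_schwartz_le {σ : ℝ} (hσ : 0 ≤ σ) {p : ℝ≥0∞} [Fact (1 ≤ p)]
    (hp₁ : 1 < p) (hp₂ : p < ∞) :
    ∃ C : ℝ, 0 ≤ C ∧ ∀ s : 𝓢(ℝ, ℂ), (∀ ξ : ℝ, σ / (2 * Real.pi) < |ξ| → 𝓕 s ξ = 0) → ∀ x,
      ‖s x‖ ≤ C * ‖s.toLp p volume‖ := by
  obtain ⟨C, hC0, hC⟩ := exists_norm_trigSum_le hσ hp₁ hp₂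
  refine ⟨C, hC0, fun s hs x => ?_⟩
  rw [SchwartzMap.norm_toLp]
  refine le_of_tendsto ((tendstoUniformly_truncTrigSum_schwartz hσ s hs).tendsto_at x).norm ?_
  filter_upwards [eventually_ge_atTop 1] with τ hτ
  exact (norm_indicator_le_norm_self _ _).trans (hC s (s.memLp p volume) τ hτ x)

/-! ### The continuous representative and uniform convergence -/

/-- A function in the Bernstein space has a bounded continuous representative, and band-limited
Schwartz functions close to it in `L^p` are uniformly close to that representative. -/
lemma exists_continuous_representative {σ : ℝ} (hσ : 0 ≤ σ) {p : ℝ≥0∞} [Fact (1 ≤ p)]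
    (hp₁ : 1 < p) (hp₂ : p < ∞) {f : Lp ℂ p (volume : Measure ℝ)} (hf : f ∈ bernsteinSpace σ p) :
    ∃ g : BoundedContinuousFunction ℝ ℂ, f =ᵐ[volume] g ∧ ∃ C : ℝ, 0 ≤ C ∧ ∀ t : 𝓢(ℝ, ℂ),
      (∀ ξ : ℝ, (σ + 1) / (2 * Real.pi) < |ξ| → 𝓕 t ξ = 0) → ∀ x,
        ‖t x - g x‖ ≤ C * ‖t.toLp p volume - f‖ := by
  obtain ⟨C, hC0, hC⟩ :=
    exists_norm_bandlimited_schwartz_le (by linarith : 0 ≤ σ + 1) hp₁ hp₂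
  obtain ⟨s, hs, hsf⟩ := exists_bandlimited_schwartz_tendsto hσ (lt_add_one σ) hp₁ hp₂ hf
  have hsub : ∀ a b : 𝓢(ℝ, ℂ), (a - b).toLp p volume = a.toLp p volume - b.toLp p volume :=
    fun a b => map_sub (SchwartzMap.toLpCLM ℝ ℂ p volume) a b
  have hdiff : ∀ a b : 𝓢(ℝ, ℂ), (∀ ξ : ℝ, (σ + 1) / (2 * Real.pi) < |ξ| → 𝓕 a ξ = 0) →
      (∀ ξ : ℝ, (σ + 1) / (2 * Real.pi) < |ξ| → 𝓕 b ξ = 0) → ∀ x,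
      ‖a x - b x‖ ≤ C * ‖a.toLp p volume - b.toLp p volume‖ := by
    intro a b ha hb x
    rw [← hsub, ← sub_apply]
    refine hC _ (fun ξ hξ => ?_) x
    rw [← FourierTransform.fourierCLM_apply (R := ℂ), map_sub, FourierTransform.fourierCLM_apply,
      FourierTransform.fourierCLM_apply, sub_apply, ha ξ hξ, hb ξ hξ, sub_zero]
  have hcauchy : CauchySeq fun n => (s n).toBoundedContinuousFunction := by
    rw [Metric.cauchySeq_iff']
    intro ε hε
    obtain ⟨N, hN⟩ := Metric.cauchySeq_iff'.1 hsf.cauchySeq (ε / (C + 1)) (by positivity)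
    refine ⟨N, fun n hn => ?_⟩
    have h1 := hN n hn
    rw [dist_eq_norm, lt_div_iff₀ (by positivity)] at h1
    refine lt_of_le_of_lt ((BoundedContinuousFunction.dist_le
      (C := C * ‖(s n).toLp p volume - (s N).toLp p volume‖) (by positivity)).2 fun x => ?_) ?_
    · rw [dist_eq_norm]
      exact hdiff _ _ (hs n) (hs N) x
    · nlinarith [norm_nonneg ((s n).toLp p volume - (s N).toLp p volume)]
  obtain ⟨g, hg⟩ := cauchySeq_tendsto_of_complete hcauchy
  have hgx : ∀ x, Tendsto (fun n => s n x) atTop (𝓝 (g x)) := fun x =>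
    (BoundedContinuousFunction.tendsto_iff_tendstoUniformly.1 hg).tendsto_at x
  refine ⟨g, ?_, C, hC0, fun t ht x => ?_⟩
  · obtain ⟨ns, hns, hae⟩ := (tendstoInMeasure_of_tendsto_Lp hsf).exists_seq_tendsto_ae
    have hcoe : ∀ᵐ x, ∀ n, (s n).toLp p volume x = s n x :=
      ae_all_iff.2 fun n => (s n).coeFn_toLp p volume
    filter_upwards [hae, hcoe] with x hx hc
    refine tendsto_nhds_unique hx (((hgx x).comp hns.tendsto_atTop).congr fun n => ?_)
    exact (hc (ns n)).symm
  · have h1 : Tendsto (fun n => ‖t x - s n x‖) atTop (𝓝 ‖t x - g x‖) :=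
      ((hgx x).const_sub (t x)).norm
    have h2 : Tendsto (fun n => C * ‖t.toLp p volume - (s n).toLp p volume‖) atTop
        (𝓝 (C * ‖t.toLp p volume - f‖)) := ((hsf.const_sub _).norm).const_mul C
    exact le_of_tendsto_of_tendsto' h1 h2 fun n => hdiff t (s n) ht (hs n) x

lemma trigSum_sub {p : ℝ≥0∞} [Fact (1 ≤ p)] {f g : ℝ → ℂ} (hf : MemLp f p volume)
    (hg : MemLp g p volume) (σ τ x : ℝ) :
    trigSum σ (fun t => f t - g t) τ x = trigSum σ f τ x - trigSum σ g τ x := by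
  simp only [trigSum_eq_blockSum]
  exact blockSum_sub _ (intervalIntegrable_of_memLp hf _ _)
    (intervalIntegrable_of_memLp hg _ _) x

lemma norm_truncTrigSum_sub_le (σ σ' : ℝ) (f h : ℝ → ℂ) (τ x : ℝ) :
    ‖truncTrigSum σ f τ x - truncTrigSum σ' h τ x‖ ≤ ‖trigSum σ f τ x - trigSum σ' h τ x‖ := by
  unfold truncTrigSum
  by_cases hx : x ∈ Set.Icc (-τ) τ <;> simp [hx]

/-- The uniform convergence to the continuous representative: a function of the Bernstein space is
compared with a Schwartz function of bandwidth `σ + δ`, for which the convergence is known. -/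
theorem exists_tendstoUniformly_truncTrigSum {σ : ℝ} (hσ : 0 ≤ σ) {p : ℝ≥0∞} [Fact (1 ≤ p)]
    (hp₁ : 1 < p) (hp₂ : p < ∞) {f : Lp ℂ p (volume : Measure ℝ)} (hf : f ∈ bernsteinSpace σ p) :
    ∃ g : BoundedContinuousFunction ℝ ℂ, f =ᵐ[volume] g ∧
      TendstoUniformly (fun τ : ℝ => truncTrigSum σ f τ) g atTop := by
  obtain ⟨g, hfg, C, hC0, hC⟩ := exists_continuous_representative hσ hp₁ hp₂ hf
  refine ⟨g, hfg, ?_⟩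
  have hfm : MemLp f p volume := Lp.memLp f
  have hP : 0 < p.toReal := ENNReal.toReal_pos (zero_lt_one.trans hp₁).ne' hp₂.ne
  rw [Metric.tendstoUniformly_iff]
  intro ε hε
  -- the relative length `A` of the blocks of frequencies that may be added at a cost below `ε / 4`
  obtain ⟨A, hA0, hA⟩ : ∃ A : ℝ, 0 < A ∧ 2 * (blockConst p.toReal.conjExponent *
      A ^ (1 / p.toReal) * (eLpNorm f p volume).toReal) < ε / 4 := by
    have h1 : Tendsto (fun A : ℝ => 2 * (blockConst p.toReal.conjExponent *
        A ^ (1 / p.toReal) * (eLpNorm f p volume).toReal)) (𝓝[>] 0) (𝓝 0) := by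
      have h2 : Tendsto (fun A : ℝ => A ^ (1 / p.toReal)) (𝓝[>] 0) (𝓝 0) := by
        have := (Real.continuousAt_rpow_const 0 (1 / p.toReal) (Or.inr (by positivity))).tendsto
        rw [Real.zero_rpow (by positivity)] at this
        exact this.mono_left nhdsWithin_le_nhds
      simpa using ((h2.const_mul (blockConst p.toReal.conjExponent)).mul_const
        (eLpNorm f p volume).toReal).const_mul 2
    obtain ⟨A, h, h0⟩ := ((h1.eventually_lt_const (by positivity : 0 < ε / 4)).and
      self_mem_nhdsWithin).exists
    exact ⟨A, h0, h⟩
  set δ := min 1 (Real.pi * A) with hδ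
  have hδ0 : 0 < δ := lt_min one_pos (by positivity)
  have hδA : δ / (2 * Real.pi) ≤ A / 2 := by
    rw [div_le_iff₀ (by positivity)]
    have : δ ≤ Real.pi * A := min_le_right _ _
    linarith
  obtain ⟨C', hC'0, hC'⟩ := exists_norm_trigSum_le (by linarith : 0 ≤ σ + δ) hp₁ hp₂
  obtain ⟨s, hs, hsf⟩ :=
    exists_bandlimited_schwartz_tendsto hσ (by linarith : σ < σ + δ) hp₁ hp₂ hf
  obtain ⟨n, hn, hn'⟩ : ∃ n, C * ‖(s n).toLp p volume - f‖ < ε / 4 ∧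
      C' * ‖(s n).toLp p volume - f‖ < ε / 4 := by
    have h0 : Tendsto (fun n => ‖(s n).toLp p volume - f‖) atTop (𝓝 0) := by
      simpa using (hsf.sub_const f).norm
    have h1 := h0.const_mul C
    have h2 := h0.const_mul C'
    rw [mul_zero] at h1 h2
    exact ((h1.eventually_lt_const (by positivity)).and
      (h2.eventually_lt_const (by positivity))).exists
  set t := s n with ht
  have hband := hs n
  have htg : ∀ x, ‖t x - g x‖ ≤ C * ‖t.toLp p volume - f‖ := by
    refine hC t fun ξ hξ => hband ξ (lt_of_le_of_lt ?_ hξ)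
    gcongr
    exact min_le_left _ _
  have htm : MemLp t p volume := t.memLp p volume
  have hnorm : (eLpNorm (fun x => f x - t x) p volume).toReal = ‖t.toLp p volume - f‖ := by
    rw [norm_sub_rev, Lp.norm_def]
    congr 1
    refine eLpNorm_congr_ae ?_
    filter_upwards [Lp.coeFn_sub f (t.toLp p volume), t.coeFn_toLp p volume] with x h1 h2
    rw [h1, Pi.sub_apply, h2]
  have hunif := Metric.tendstoUniformly_iff.1
    (tendstoUniformly_truncTrigSum_schwartz (by linarith) t hband) (ε / 4) (by positivity)
  filter_upwards [hunif, eventually_ge_atTop 1, eventually_ge_atTop A⁻¹] with τ hτu hτ1 hτA x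
  have hτ0 : 0 < τ := by linarith
  have hAτ : (σ + δ - σ) / (2 * Real.pi) + 1 / (2 * τ) ≤ A := by
    have : 1 / (2 * τ) ≤ A / 2 := by
      rw [div_le_iff₀ (by linarith)]
      have := mul_le_mul_of_nonneg_left hτA hA0.le
      rw [mul_inv_cancel₀ hA0.ne'] at this
      linarith
    rw [add_sub_cancel_left]
    linarith
  have h1 : ‖truncTrigSum σ f τ x - truncTrigSum (σ + δ) f τ x‖ < ε / 4 := by
    exact ((norm_truncTrigSum_sub_le _ _ _ _ _ _).trans
      (norm_trigSum_sub_trigSum_le hσ (by linarith) hp₁ hp₂ hfm hτ0 hA0 hAτ x)).trans_lt hA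
  have h2 : ‖truncTrigSum (σ + δ) f τ x - truncTrigSum (σ + δ) t τ x‖ < ε / 4 := by
    refine (norm_truncTrigSum_sub_le _ _ _ _ _ _).trans_lt ?_
    rw [← trigSum_sub hfm htm]
    refine (hC' _ (hfm.sub htm) τ hτ1 x).trans_lt ?_
    change C' * (eLpNorm (fun x => f x - t x) p volume).toReal < ε / 4
    rwa [hnorm]
  have h3 : ‖truncTrigSum (σ + δ) t τ x - t x‖ < ε / 4 := by
    have := hτu x
    rwa [dist_comm, dist_eq_norm] at this
  have h4 : ‖t x - g x‖ < ε / 4 := (htg x).trans_lt hn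
  rw [dist_comm, dist_eq_norm]
  calc _ = ‖(truncTrigSum σ f τ x - truncTrigSum (σ + δ) f τ x) +
        (truncTrigSum (σ + δ) f τ x - truncTrigSum (σ + δ) t τ x) +
        (truncTrigSum (σ + δ) t τ x - t x) + (t x - g x)‖ := by congr 1; ring
    _ ≤ _ := norm_add₄_le
    _ < ε := by linarith

/-! ### Norms in `L^∞` -/

lemma memLp_top_truncTrigSum (σ : ℝ) (f : ℝ → ℂ) (τ : ℝ) :
    MemLp (truncTrigSum σ f τ) ∞ volume := by
  have hc : Continuous (trigSum σ f τ) := by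
    unfold trigSum
    fun_prop
  refine MemLp.indicator measurableSet_Icc (memLp_top_of_bound hc.aestronglyMeasurable
    (∑ k ∈ Finset.Icc (-⌊σ * τ / Real.pi⌋) ⌊σ * τ / Real.pi⌋, ‖expCoeff f τ k‖)
    (Eventually.of_forall fun x => ?_))
  refine norm_sum_le_of_le _ fun k _ => ?_
  rw [norm_mul, norm_exp_frequency, mul_one]

lemma tendsto_eLpNorm_top_sub_of_tendstoUniformly {ψ : ℝ → ℝ → ℂ} {f g : ℝ → ℂ}
    (hfg : f =ᵐ[volume] g) (h : TendstoUniformly ψ g atTop) :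
    Tendsto (fun τ : ℝ => eLpNorm (fun x => f x - ψ τ x) ∞ volume) atTop (𝓝 0) := by
  rw [ENNReal.tendsto_nhds_zero]
  intro ε hε
  obtain ⟨r, hr0, hrε⟩ : ∃ r : ℝ, 0 < r ∧ ENNReal.ofReal r ≤ ε := by
    obtain ⟨r, -, h0, h1⟩ := ENNReal.lt_iff_exists_real_btwn.1 hε
    exact ⟨r, ENNReal.ofReal_pos.1 h0, h1.le⟩
  filter_upwards [Metric.tendstoUniformly_iff.1 h r hr0] with τ hτ
  refine le_trans ?_ hrε
  rw [eLpNorm_exponent_top]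
  refine eLpNormEssSup_le_of_ae_bound ?_
  filter_upwards [hfg] with x hx
  rw [hx, ← dist_eq_norm]
  exact (hτ x).le

lemma tendsto_eLpNorm_top_of_tendsto_sub {ψ : ℝ → ℝ → ℂ} {f : ℝ → ℂ} (hf : MemLp f ∞ volume)
    (hψ : ∀ τ, MemLp (ψ τ) ∞ volume)
    (h : Tendsto (fun τ : ℝ => eLpNorm (fun x => f x - ψ τ x) ∞ volume) atTop (𝓝 0)) :
    Tendsto (fun τ => eLpNorm (ψ τ) ∞ volume) atTop (𝓝 (eLpNorm f ∞ volume)) := by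
  have hlow := ENNReal.Tendsto.sub (tendsto_const_nhds (x := eLpNorm f ∞ volume)) h
    (Or.inl hf.eLpNorm_ne_top)
  have hup := (tendsto_const_nhds (x := eLpNorm f ∞ volume)).add h
  rw [tsub_zero] at hlow
  rw [add_zero] at hup
  refine tendsto_of_tendsto_of_tendsto_of_le_of_le hlow hup (fun τ => ?_) fun τ => ?_
  · refine tsub_le_iff_right.2 ?_
    have := eLpNorm_add_le (hψ τ).aestronglyMeasurable
      (hf.sub (hψ τ)).aestronglyMeasurable (p := ∞) le_top
    rwa [add_sub_cancel] at this
  · have := eLpNorm_sub_le hf.aestronglyMeasurable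
      (hf.sub (hψ τ)).aestronglyMeasurable (p := ∞) le_top
    rwa [sub_sub_cancel] at this

theorem theorem2 (σ : ℝ) (hσ : 0 < σ) (p : ℝ≥0∞) [Fact (1 ≤ p)] (hp₁ : 1 < p) (hp₂ : p < ∞)
    (f : Lp ℂ p (volume : Measure ℝ)) (hf : f ∈ bernsteinSpace σ p) :
    Tendsto (fun τ : ℝ => eLpNorm (fun x => f x - truncTrigSum σ f τ x) ∞ volume) atTop (𝓝 0) ∧
    (∃ g : ℝ → ℂ, Continuous g ∧ f =ᵐ[volume] g ∧
      TendstoUniformly (fun τ : ℝ => truncTrigSum σ f τ) g atTop) ∧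
    ConvergesNarrowly atTop (fun τ : ℝ => truncTrigSum σ f τ) f := by
  obtain ⟨g, hfg, hg⟩ := exists_tendstoUniformly_truncTrigSum hσ.le hp₁ hp₂ hf
  have hlim := tendsto_eLpNorm_top_sub_of_tendstoUniformly hfg hg
  have hfm : MemLp f ∞ volume :=
    (memLp_congr_ae hfg).2 (memLp_top_of_bound g.continuous.aestronglyMeasurable ‖g‖
      (Eventually.of_forall g.norm_coe_le_norm))
  refine ⟨hlim, ⟨g, g.continuous, hfg, hg⟩, ?_⟩
  exact
    { memLp := memLp_top_truncTrigSum σ f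
      memLp_limit := hfm
      uniform_on_compacts := fun K _ => tendsto_of_tendsto_of_tendsto_of_le_of_le tendsto_const_nhds
        hlim (fun _ => zero_le) fun τ => eLpNorm_mono_measure _ Measure.restrict_le_self
      norm_tendsto := tendsto_eLpNorm_top_of_tendsto_sub hfm (memLp_top_truncTrigSum σ f) hlim }
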